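/- A metric space may have distances $\infty$. Let $\mathbf{Met}$ be the category of metric spaces and nonexpanding maps and $\mathbf{CMet}$ its full subcategory of complete spaces; let $\mathcal{C}$ be either of them. It is enriched by the distances $d(f,g)=\sup_{x\in X}d(f(x),g(x))$ for $f,g\colon X\to Y$. An endofunctor $T$ of $\mathcal{C}$ is enriched if $d(Tf,Tg)\le d(f,g)$ for all parallel $f,g$, and natural transformations $\alpha,\beta\colon F\to G$ have the distance $d(\alpha,\beta)=\sup_X d(\alpha_X,\beta_X)$. Let $K$ be the inclusion into $\mathcal{C}$ of the full subcategory of finite discrete spaces (those in which distinct points have distance $\infty$). An enriched endofunctor $T$ is strongly finitary if $T=\mathrm{Lan}_K\,TK$, that is, if for every enriched endofunctor $G$ of $\mathcal{C}$ the restriction $\beta\mapsto\beta K$ is an isometric bijection from the natural transformations $T\to G$ to the natural transformations $TK\to GK$. A monad is strongly finitary if its underlying endofunctor is. Let $\Sigma=(\Sigma_n)_{n\in\mathbb{N}}$ be a signature. A (complete) quantitative algebra is a (complete) metric space $A$ with operations $\sigma_A\colon A^n\to A$ ($\sigma\in\Sigma_n$) that are nonexpanding with respect to the maximum metric on $A^n$;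 morphisms are the nonexpanding homomorphisms. A quantitative equation $t=_\varepsilon t'$ consists of two $\Sigma$-terms over a finite set $V$ of variables and a real number $\varepsilon\ge 0$; the algebra $A$ satisfies it if under every interpretation $V\to A$ the values of $t$ and $t'$ have distance at most $\varepsilon$. A variety $\mathcal{V}$ of (complete) quantitative algebras is the full subcategory of all (complete) quantitative algebras that satisfy a given set of quantitative equations. Its free-algebra monad $T_{\mathcal{V}}$ on $\mathbf{Met}$ (on $\mathbf{CMet}$, in the complete case) is the monad of the adjunction between the forgetful functor of $\mathcal{V}$ and its left adjoint. **Theorem 6.10.** Suppose that all operation symbols of $\Sigma$ have arity at most $1$. Then for every variety $\mathcal{V}$ of quantitative $\Sigma$-algebras the forgetful functor $\mathcal{V}\to\mathbf{Met}$ has a left adjoint and the monad $T_{\mathcal{V}}$ on $\mathbf{Met}$ is strongly finitary. Likewise, for every variety $\mathcal{V}$ of complete quantitative $\Sigma$-algebras the forgetful functor $\mathcal{V}\to\mathbf{CMet}$ has a left adjoint and the monad $T_{\mathcal{V}}$ on $\mathbf{CMet}$ is strongly finitary. -/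

import Mathlib

open CategoryTheory
open scoped NNReal ENNReal

universe w v u

namespace QuantAlg

/-! ## The categories of (complete) extended metric spaces -/

/-- An extended metric space: the distance `∞` is allowed. -/
structure Met : Type (u + 1) where
  carrier : Type u
  [metric : EMetricSpace carrier]

instance : CoeSort Met.{u} (Type u) := ⟨Met.carrier⟩

instance (X : Met.{u}) : EMetricSpace X := X.metric

/-- Nonexpanding maps. -/
@[ext]
structure Met.Hom (X Y : Met.{u}) : Type u where
  toFun : X → Y
  nonexpanding : ∀ x x' : X, edist (toFun x) (toFun x') ≤ edist x x'

instance : Category Met.{u} where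
  Hom := Met.Hom
  id X := ⟨fun x => x, fun _ _ => le_rfl⟩
  comp f g := ⟨fun x => g.toFun (f.toFun x),
    fun x x' => (g.nonexpanding _ _).trans (f.nonexpanding x x')⟩

/-- The full subcategory of complete spaces. -/
abbrev CMet : Type (u + 1) :=
  ObjectProperty.FullSubcategory (fun X : Met.{u} => CompleteSpace X)

/-- The inclusion of complete spaces into all spaces. -/
abbrev CMet.incl : CMet.{u} ⥤ Met.{u} :=
  ObjectProperty.ι (fun X : Met.{u} => CompleteSpace X)

/-! ## Enriched functors and strongly finitary functors

In this section `U : C ⥤ Met` is the functor through which the hom-sets of `C` get their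
supremum metric. It is `𝟭 Met` for `C = Met` and the inclusion for `C = CMet`. -/

section Enriched

variable {C : Type w} [Category.{v} C] (U : C ⥤ Met.{u})

/-- The supremum distance of parallel morphisms. -/
noncomputable def homDist {X Y : C} (f g : X ⟶ Y) : ℝ≥0∞ :=
  ⨆ x : U.obj X, edist ((U.map f).toFun x) ((U.map g).toFun x)

/-- Enriched endofunctors: the locally nonexpanding ones. -/
def IsEnriched (T : C ⥤ C) : Prop :=
  ∀ ⦃X Y : C⦄ (f g : X ⟶ Y), homDist U (T.map f) (T.map g) ≤ homDist U f g

/-- The distance of natural transformations, the supremum of the distances of components. -/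
noncomputable def natDist {A : Type*} [Category A] {F G : A ⥤ C} (α β : F ⟶ G) : ℝ≥0∞ :=
  ⨆ X : A, homDist U (α.app X) (β.app X)

/-- The enriched endofunctor `T`, with the unit `τ`, is the enriched left Kan extension of `F`
along the inclusion `K` of a full subcategory: precomposition with `K` followed by `τ` is an
isometric bijection from the natural transformations `T ⟶ G` to the natural transformations
`F ⟶ K ⋙ G`, for every enriched endofunctor `G`. -/
structure IsEnrichedLan (P : ObjectProperty C) (F : P.FullSubcategory ⥤ C) (T : C ⥤ C)
    (τ : F ⟶ P.ι ⋙ T) : Prop where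
  enriched : IsEnriched U T
  existsUnique : ∀ G : C ⥤ C, IsEnriched U G → ∀ α : F ⟶ P.ι ⋙ G,
    ∃! β : T ⟶ G, τ ≫ Functor.whiskerLeft P.ι β = α
  isometric : ∀ G : C ⥤ C, IsEnriched U G → ∀ β β' : T ⟶ G,
    natDist U (τ ≫ Functor.whiskerLeft P.ι β) (τ ≫ Functor.whiskerLeft P.ι β') = natDist U β β'

/-- The finite discrete spaces: distinct points have distance `∞`. -/
def finDiscrete : ObjectProperty C :=
  fun X => Finite (U.obj X) ∧ ∀ x y : U.obj X, x ≠ y → edist x y = ∞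

/-- `T` is enriched, and it is the left Kan extension of its restriction to the finite discrete
spaces. -/
def IsStronglyFinitary (T : C ⥤ C) : Prop :=
  IsEnrichedLan U (finDiscrete U) ((finDiscrete U).ι ⋙ T) T (𝟙 _)

end Enriched

/-! ## Quantitative algebras -/

/-- Finitary signatures: `S n` is the set of `n`-ary operation symbols. -/
abbrev Signature : Type (u + 1) := ℕ → Type u

/-- Terms over a set `V` of variables. -/
inductive Term (S : Signature.{u}) (V : Type v) : Type (max u v) where
  | var (x : V) : Term S V
  | app {n : ℕ} (σ : S n) (t : Fin n → Term S V) : Term S V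

/-- Quantitative algebras: the operations are nonexpanding with respect to the maximum metric. -/
structure Alg (S : Signature.{u}) : Type (u + 1) where
  space : Met.{u}
  op : ∀ {n : ℕ}, S n → (Fin n → space) → space
  nonexpanding : ∀ {n : ℕ} (σ : S n) (a b : Fin n → space),
    edist (op σ a) (op σ b) ≤ ⨆ i, edist (a i) (b i)

/-- Nonexpanding homomorphisms. -/
@[ext]
structure Alg.Hom {S : Signature.{u}} (A B : Alg S) : Type u where
  map : A.space ⟶ B.space
  map_op : ∀ {n : ℕ} (σ : S n) (a : Fin n → A.space),
    map.toFun (A.op σ a) = B.op σ (fun i => map.toFun (a i))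

instance (S : Signature.{u}) : Category (Alg S) where
  Hom := Alg.Hom
  id A := ⟨𝟙 A.space, fun _ _ => rfl⟩
  comp {A B D} f g := ⟨f.map ≫ g.map, fun σ a =>
    (congrArg g.map.toFun (f.map_op σ a)).trans (g.map_op σ _)⟩

/-- The forgetful functor to metric spaces. -/
def Alg.forget (S : Signature.{u}) : Alg S ⥤ Met.{u} where
  obj A := A.space
  map f := f.map

/-- The value of a term under an interpretation of the variables. -/
def Alg.eval {S : Signature.{u}} (A : Alg S) {V : Type v} (f : V → A.space) :
    Term S V → A.space
  | .var x => f x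
  | .app σ t => A.op σ (fun i => A.eval f (t i))

/-- A quantitative equation `lhs =_ε rhs` between terms over a finite set of variables. -/
structure Equation (S : Signature.{u}) : Type u where
  numVars : ℕ
  lhs : Term S (Fin numVars)
  rhs : Term S (Fin numVars)
  ε : ℝ≥0

/-- Satisfaction of a quantitative equation under every interpretation of the variables. -/
def Alg.Satisfies {S : Signature.{u}} (A : Alg S) (e : Equation S) : Prop :=
  ∀ f : Fin e.numVars → A.space, edist (A.eval f e.lhs) (A.eval f e.rhs) ≤ (e.ε : ℝ≥0∞)

/-- The variety of quantitative algebras specified by a set of quantitative equations. -/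
abbrev Variety {S : Signature.{u}} (E : Set (Equation S)) : Type (u + 1) :=
  ObjectProperty.FullSubcategory (fun A : Alg S => ∀ e ∈ E, A.Satisfies e)

/-- The forgetful functor of a variety. -/
def Variety.forget {S : Signature.{u}} (E : Set (Equation S)) : Variety E ⥤ Met.{u} :=
  ObjectProperty.ι _ ⋙ Alg.forget S

/-- The variety of complete quantitative algebras specified by a set of quantitative equations. -/
abbrev CVariety {S : Signature.{u}} (E : Set (Equation S)) : Type (u + 1) :=
  ObjectProperty.FullSubcategory
    (fun A : Alg S => (∀ e ∈ E, A.Satisfies e) ∧ CompleteSpace A.space)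

/-- The forgetful functor of a variety of complete algebras to complete spaces. -/
def CVariety.forget {S : Signature.{u}} (E : Set (Equation S)) : CVariety E ⥤ CMet.{u} :=
  ObjectProperty.lift _ (ObjectProperty.ι _ ⋙ Alg.forget S) (fun A => A.property.2)

end QuantAlg

namespace QuantAlg

/-! The free algebra on `X` is the set of terms over `X` with the largest pseudometric `freeDist`
for which variables and operations are nonexpanding and the equations hold, made separated and, in
the complete case, completed. Evaluation in any algebra of the variety induces a pseudometric of
this kind, hence is nonexpanding for `freeDist`; this is the universal property. The proposition `c`
says whether completeness is required, so that one argument serves both categories.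

For strong finitarity, let `α` be given on finite discrete spaces. Every term over `X` is the image
of a term over a finite discrete `K` under some map `K ⟶ X`, so naturality forces the value of an
extension of `α` at it. The value does not depend on the choices, since two representations factor
through a common finite discrete subset (`extValue_congr`).

The crux is that the resulting map is nonexpanding for `freeDist` over `X`. The distance `d` it
induces on terms satisfies `d (u x) (u y) ≤ edist x y` for one-variable terms `u`, because `G` is
enriched, and is bounded by `freeDist` on terms from finite discrete spaces. By
`le_freeDist_of_unary` these two facts give `d ≤ freeDist`. Arity at most one enters here: with a
binary operation, changing the arguments one at a time would add their distances instead of taking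
the maximum. -/

/-! ## Generating maps -/

section Generating

variable {c : Prop} {W : Type*} {Z : Type*} {Y : Type*}

/-- Maps with dense range; when completeness is not required (`¬ c`), surjective maps. -/
def IsGenerating [EMetricSpace Z] (c : Prop) (e : W → Z) : Prop :=
  DenseRange e ∧ (¬ c → Function.Surjective e)

theorem lipschitzWith_one_of_edist_le [PseudoEMetricSpace Z] [PseudoEMetricSpace Y] {g : Z → Y}
    (hg : ∀ z z', edist (g z) (g z') ≤ edist z z') : LipschitzWith 1 g :=
  fun z z' => by simpa using hg z z'

theorem continuous_of_edist_le [PseudoEMetricSpace Z] [PseudoEMetricSpace Y] {g : Z → Y}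
    (hg : ∀ z z', edist (g z) (g z') ≤ edist z z') : Continuous g :=
  (lipschitzWith_one_of_edist_le hg).continuous

/-- Bounds for the distance of two nonexpanding maps can be tested on a dense range. -/
theorem _root_.DenseRange.edist_le_of_forall [EMetricSpace Z] [EMetricSpace Y] {e : W → Z}
    (he : DenseRange e) {g g' : Z → Y} (hg : Continuous g) (hg' : Continuous g') {r : ℝ≥0∞}
    (h : ∀ w, edist (g (e w)) (g' (e w)) ≤ r) (z : Z) : edist (g z) (g' z) ≤ r :=
  he.induction_on z (isClosed_le (hg.edist hg') continuous_const) h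

/-- Nonexpanding maps extend along generating maps. -/
theorem IsGenerating.exists_extension [EMetricSpace Z] [EMetricSpace Y] {e : W → Z}
    (he : IsGenerating c e) (hY : c → CompleteSpace Y) (f : W → Y)
    (hf : ∀ w w', edist (f w) (f w') ≤ edist (e w) (e w')) :
    ∃ g : Z → Y, (∀ z z', edist (g z) (g z') ≤ edist z z') ∧ ∀ w, g (e w) = f w := by
  -- Continuity suffices: the required inequality is a closed condition and holds on the dense
  -- range.
  suffices h : ∃ g : Z → Y, Continuous g ∧ ∀ w, g (e w) = f w by
    obtain ⟨g, hg, hgf⟩ := h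
    refine ⟨g, fun z z' => ?_, hgf⟩
    refine he.1.induction_on₂ (p := fun z z' => edist (g z) (g z') ≤ edist z z') ?_ ?_ z z'
    · exact isClosed_le ((hg.comp continuous_fst).edist (hg.comp continuous_snd)) continuous_edist
    · intro w w'
      simpa only [hgf] using hf w w'
  by_cases hc : c
  · have := hY hc
    -- With the metric pulled back along `e`, the hypothesis `hf` says that `f` is 1-Lipschitz, so
    -- it extends to the complete space `Y`.
    let _ : PseudoEMetricSpace W := PseudoEMetricSpace.induced e inferInstance
    have hi : IsUniformInducing e := ⟨rfl⟩
    have hfu : UniformContinuous f := (lipschitzWith_one_of_edist_le hf).uniformContinuous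
    exact ⟨_, (uniformContinuous_uniformly_extend hi he.1 hfu).continuous,
      fun w => uniformly_extend_of_ind hi he.1 hfu w⟩
  · have hs := he.2 hc
    refine ⟨fun z => f (hs z).choose, continuous_of_edist_le fun z z' => ?_, fun w => ?_⟩
    · have := hf (hs z).choose (hs z').choose
      rwa [(hs z).choose_spec, (hs z').choose_spec] at this
    · have := hf (hs (e w)).choose w
      rw [(hs (e w)).choose_spec, edist_self] at this
      exact edist_le_zero.1 this

theorem IsGenerating.comp [EMetricSpace Z] [EMetricSpace Y] {e : W → Z}
    (he : IsGenerating c e) {g : Z → Y} (hg : Continuous g) (hs : Function.Surjective g) :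
    IsGenerating c (g ∘ e) :=
  ⟨hs.denseRange.comp he.1 hg, fun hc => hs.comp (he.2 hc)⟩

theorem IsGenerating.pi [EMetricSpace Z] {e : W → Z} (he : IsGenerating c e) (n : ℕ) :
    IsGenerating c (fun (t : Fin n → W) i => e (t i)) :=
  ⟨DenseRange.piMap fun _ => he.1, fun hc => (he.2 hc).comp_left⟩

end Generating

/-! ## Completion of extended pseudometric spaces -/

section Completion

/-- The points of the completion of `W`, represented by their distances from the points of `W`. -/
@[ext]
structure ECompletion (W : Type u) [PseudoEMetricSpace W] : Type u where
  distFrom : W → ℝ≥0∞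
  le_add : ∀ x y, distFrom x ≤ distFrom y + edist x y
  edist_le : ∀ x y, edist x y ≤ distFrom x + distFrom y
  exists_lt : ∀ ε, 0 < ε → ∃ x, distFrom x < ε

namespace ECompletion

variable {W : Type u} [PseudoEMetricSpace W]

noncomputable instance : EMetricSpace (ECompletion W) where
  -- The shortest detour through a point of `W`. The field `exists_lt` puts points of `W`
  -- arbitrarily near `φ`, which makes the self-distance zero.
  edist φ ψ := ⨅ x, φ.distFrom x + ψ.distFrom x
  edist_self φ := by
    refine le_antisymm (ENNReal.le_of_forall_pos_le_add fun ε hε _ => ?_) zero_le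
    obtain ⟨x, hx⟩ := φ.exists_lt (ε / 2 : ℝ≥0∞) (by simpa using hε.ne')
    rw [zero_add]
    exact (iInf_le _ x).trans ((add_le_add hx.le hx.le).trans (ENNReal.add_halves _).le)
  edist_comm φ ψ := by simp only [add_comm]
  edist_triangle φ ψ χ := by
    simp only [ENNReal.iInf_add, ENNReal.add_iInf]
    refine le_iInf fun x => le_iInf fun y => (iInf_le _ x).trans ?_
    calc φ.distFrom x + χ.distFrom x
        ≤ φ.distFrom y + (ψ.distFrom x + ψ.distFrom y) + χ.distFrom x := by
          gcongr
          exact (φ.le_add x y).trans (by gcongr; exact ψ.edist_le x y)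
      _ = _ := by ring
  eq_of_edist_eq_zero {φ ψ} h := by
    have key : ∀ φ ψ : ECompletion W, (⨅ x, φ.distFrom x + ψ.distFrom x) = 0 →
        ∀ x, φ.distFrom x ≤ ψ.distFrom x := by
      intro φ ψ h x
      rw [← add_zero (ψ.distFrom x), ← h, ENNReal.add_iInf]
      refine le_iInf fun y => ?_
      calc φ.distFrom x ≤ φ.distFrom y + edist x y := φ.le_add x y
        _ ≤ φ.distFrom y + (ψ.distFrom x + ψ.distFrom y) := by gcongr; exact ψ.edist_le x y
        _ = _ := by ring
    refine ECompletion.ext (funext fun x => le_antisymm (key φ ψ h x) (key ψ φ ?_ x))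
    simpa only [add_comm] using h

theorem edist_def (φ ψ : ECompletion W) :
    edist φ ψ = ⨅ x, φ.distFrom x + ψ.distFrom x := rfl

/-- The embedding of a space into its completion. -/
def of (x : W) : ECompletion W where
  distFrom y := edist x y
  le_add y z := by rw [edist_comm y z]; exact edist_triangle x z y
  edist_le y z := edist_triangle_left y z x
  exists_lt ε hε := ⟨x, by simpa using hε⟩

theorem edist_of_left (x : W) (φ : ECompletion W) : edist (of x) φ = φ.distFrom x := by
  rw [edist_def]
  refine le_antisymm ((iInf_le _ x).trans (by simp [of])) (le_iInf fun y => ?_)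
  rw [add_comm]
  exact φ.le_add x y

theorem edist_of_of (x y : W) : edist (of x) (of y) = edist x y := by
  rw [edist_of_left, edist_comm]
  rfl

theorem denseRange_of : DenseRange (of : W → ECompletion W) := by
  intro φ
  rw [EMetric.mem_closure_iff]
  intro ε hε
  obtain ⟨x, hx⟩ := φ.exists_lt ε hε
  exact ⟨of x, ⟨x, rfl⟩, by rwa [edist_comm, edist_of_left]⟩

/-- The limit in the completion of a Cauchy filter. -/
noncomputable def limit (f : Filter W) (hf : Cauchy f) : ECompletion W where
  -- The upper limit of the distances to `y` along `f`.
  distFrom y := ⨅ s : {s : Set W // s ∈ f}, ⨆ x : s.1, edist x.1 y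
  le_add y z := by
    rw [ENNReal.iInf_add]
    refine le_iInf fun s => (iInf_le _ s).trans (iSup_le fun x => ?_)
    rw [edist_comm y z]
    exact (edist_triangle x.1 z y).trans (by gcongr; exact le_iSup (fun x : s.1 => edist x.1 z) x)
  edist_le y z := by
    simp only [ENNReal.iInf_add, ENNReal.add_iInf]
    refine le_iInf fun s => le_iInf fun t => ?_
    have := hf.1
    obtain ⟨x, hxs, hxt⟩ := f.nonempty_of_mem (Filter.inter_mem s.2 t.2)
    exact (edist_triangle_left y z x).trans (add_le_add
      (le_iSup (fun x : t.1 => edist x.1 y) ⟨x, hxt⟩)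
      (le_iSup (fun x : s.1 => edist x.1 z) ⟨x, hxs⟩))
  exists_lt ε hε := by
    obtain ⟨δ, hδ, hδε⟩ := exists_between hε
    obtain ⟨s, hs, h⟩ := (EMetric.cauchy_iff.1 hf).2 δ hδ
    obtain ⟨x, hx⟩ := hf.1.nonempty_of_mem hs
    refine ⟨x, lt_of_le_of_lt ?_ hδε⟩
    exact iInf_le_of_le ⟨s, hs⟩ (iSup_le fun y => (h y.1 y.2 x hx).le)

instance : CompleteSpace (ECompletion W) := by
  refine completeSpace_extension (m := (of : W → ECompletion W))
    (Isometry.isUniformInducing fun x y => edist_of_of x y) denseRange_of fun f hf =>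
      ⟨limit f hf, ?_⟩
  rw [Metric.nhds_basis_eball.ge_iff]
  intro ε hε
  obtain ⟨δ, hδ, hδε⟩ := exists_between hε
  obtain ⟨s, hs, h⟩ := (EMetric.cauchy_iff.1 hf).2 δ hδ
  refine Filter.mem_map.2 (Filter.mem_of_superset hs fun x hx => ?_)
  rw [Set.mem_preimage, Metric.mem_eball, edist_of_left]
  refine lt_of_le_of_lt ?_ hδε
  exact iInf_le_of_le ⟨s, hs⟩ (iSup_le fun y => (h y.1 y.2 x hx).le)

end ECompletion

/-- Every extended pseudometric space generates a separated (and complete, if required) one. -/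
theorem exists_isGenerating (c : Prop) (W : Type u) [PseudoEMetricSpace W] :
    ∃ (Z : Met.{u}) (e : W → Z), (c → CompleteSpace Z) ∧ IsGenerating c e ∧
      ∀ x y, edist (e x) (e y) = edist x y := by
  by_cases hc : c
  · exact ⟨⟨ECompletion W⟩, ECompletion.of, fun _ => inferInstanceAs (CompleteSpace (ECompletion W)),
      ⟨ECompletion.denseRange_of, fun h => absurd hc h⟩, ECompletion.edist_of_of⟩
  · exact ⟨⟨SeparationQuotient W⟩, SeparationQuotient.mk, fun h => absurd h hc,
      ⟨SeparationQuotient.surjective_mk.denseRange, fun _ => SeparationQuotient.surjective_mk⟩,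
      SeparationQuotient.edist_mk⟩

end Completion

/-! ## Terms -/

namespace Term

variable {S : Signature.{u}} {V : Type*} {W : Type*} {X : Type*}

/-- Substitution of terms for variables. -/
def subst (s : V → Term S W) : Term S V → Term S W
  | .var x => s x
  | .app σ t => .app σ fun i => (t i).subst s

/-- Renaming of variables. -/
def map (f : V → W) (t : Term S V) : Term S W :=
  t.subst fun x => .var (f x)

@[simp] theorem map_app (f : V → W) {n : ℕ} (σ : S n) (t : Fin n → Term S V) :
    (app σ t).map f = app σ fun i => (t i).map f := rfl

theorem subst_subst (s : V → Term S W) (s' : W → Term S X) (t : Term S V) :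
    (t.subst s).subst s' = t.subst fun x => (s x).subst s' := by
  induction t with
  | var x => rfl
  | app σ t ih => simp only [subst, ih]

theorem map_map (f : V → W) (g : W → X) (t : Term S V) :
    (t.map f).map g = t.map fun x => g (f x) :=
  subst_subst _ _ t

theorem subst_map (s : V → Term S W) (g : W → X) (t : Term S V) :
    (t.subst s).map g = t.subst fun x => (s x).map g :=
  subst_subst _ _ t

theorem map_id (t : Term S V) : (t.map fun x => x) = t := by
  induction t with
  | var x => rfl
  | app σ t ih => simp only [map_app, ih]

theorem map_injective {f : V → W} (hf : Function.Injective f) :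
    Function.Injective (map f : Term S V → Term S W) := by
  intro t
  induction t with
  | var x =>
    intro t' h
    cases t' with
    | var y => exact congrArg var (hf (Term.var.inj h))
    | app σ t' => cases h
  | app σ t ih =>
    intro t' h
    cases t' with
    | var y => cases h
    | app σ' t' =>
      simp only [map_app, app.injEq] at h
      obtain ⟨rfl, hσ, ht⟩ := h
      obtain rfl := eq_of_heq hσ
      exact congrArg (app σ) (funext fun i => ih i (congrFun (eq_of_heq ht) i))

/-- Quantifying over all `F'` containing `F` lets the supports of several terms be merged into one
union. -/
theorem exists_finite_support (t : Term S X) :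
    ∃ F : Set X, F.Finite ∧ ∀ F', F ⊆ F' → ∃ t' : Term S F', t'.map Subtype.val = t := by
  induction t with
  | var x => exact ⟨{x}, Set.finite_singleton x, fun F' h => ⟨var ⟨x, h rfl⟩, rfl⟩⟩
  | app σ t ih =>
    choose F hF h using ih
    refine ⟨⋃ i, F i, Set.finite_iUnion hF, fun F' hF' => ?_⟩
    choose t' ht' using fun i => h i F' ((Set.subset_iUnion F i).trans hF')
    exact ⟨app σ t', by simp only [map_app, ht']⟩

theorem eval_subst (A : Alg S) (g : W → A.space) (s : V → Term S W) (t : Term S V) :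
    A.eval g (t.subst s) = A.eval (fun x => A.eval g (s x)) t := by
  induction t with
  | var x => rfl
  | app σ t ih => simp only [subst, Alg.eval, ih]

theorem eval_map (A : Alg S) (g : W → A.space) (f : V → W) (t : Term S V) :
    A.eval g (t.map f) = A.eval (fun x => g (f x)) t :=
  eval_subst A g _ t

end Term

/-- The discrete space on a set. -/
noncomputable def Met.discrete (K : Type u) : Met.{u} where
  carrier := K
  metric :=
    open Classical in
    { edist := fun x y => if x = y then 0 else ∞
      edist_self := fun x => if_pos rfl
      edist_comm := fun x y => if_congr eq_comm rfl rfl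
      edist_triangle := fun x y z => by
        by_cases hxy : x = y
        · subst hxy
          simp
        · simp [hxy]
      eq_of_edist_eq_zero := fun {x y} h => by
        by_contra hxy
        simp [hxy] at h }

/-- Finite spaces in which distinct points have distance `∞`. -/
def Met.IsFinDiscrete (X : Met.{u}) : Prop :=
  Finite X ∧ ∀ x y : X, x ≠ y → edist x y = ∞

theorem Met.isFinDiscrete_discrete (K : Type u) [h : Finite K] :
    (Met.discrete K).IsFinDiscrete :=
  ⟨h, fun _ _ hxy => if_neg hxy⟩

/-- Finitely many terms involve finitely many variables. A whole family is treated at once because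
an instance of an equation substitutes several terms simultaneously. -/
theorem exists_discrete_factor {S : Signature.{u}} {X : Type u} {m : ℕ} (s : Fin m → Term S X) :
    ∃ (K : Met.{u}) (_ : K.IsFinDiscrete) (k : K → X) (s' : Fin m → Term S K),
      ∀ i, (s' i).map k = s i := by
  choose F hF h using fun i => (s i).exists_finite_support
  choose s' hs' using fun i => h i _ (Set.subset_iUnion F i)
  have : Finite (⋃ i, F i : Set X) := Set.finite_iUnion hF
  exact ⟨Met.discrete (⋃ i, F i : Set X), Met.isFinDiscrete_discrete _, Subtype.val, s', hs'⟩

/-! ## The free distance of terms -/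

section FreeDist

variable {S : Signature.{u}} (E : Set (Equation S))

/-- Pseudometrics. -/
structure IsPseudoDist {W : Type*} (d : W → W → ℝ≥0∞) : Prop where
  self : ∀ x, d x x = 0
  comm : ∀ x y, d x y = d y x
  triangle : ∀ x y z, d x z ≤ d x y + d y z

theorem isPseudoDist_edist {W Z : Type*} [PseudoEMetricSpace Z] (e : W → Z) :
    IsPseudoDist fun x y => edist (e x) (e y) :=
  ⟨fun _ => edist_self _, fun _ _ => edist_comm _ _, fun _ _ _ => edist_triangle _ _ _⟩

theorem isPseudoDist_iSup {W : Type*} {ι : Type*} {d : ι → W → W → ℝ≥0∞}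
    (h : ∀ i, IsPseudoDist (d i)) : IsPseudoDist fun x y => ⨆ i, d i x y where
  self x := by simp [(h _).self]
  comm x y := iSup_congr fun i => (h i).comm x y
  triangle x y z := iSup_le fun i => ((h i).triangle x y z).trans
    (add_le_add (le_iSup (fun i => d i x y) i) (le_iSup (fun i => d i y z) i))

/-- The pseudometrics on the terms over `X` making the variables and the operations nonexpanding
and satisfying the equations in `E`. -/
structure IsAdmissible (X : Met.{u}) (d : Term S X → Term S X → ℝ≥0∞) : Prop
    extends IsPseudoDist d where
  op : ∀ {n : ℕ} (σ : S n) (a b : Fin n → Term S X), d (.app σ a) (.app σ b) ≤ ⨆ i, d (a i) (b i)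
  eqn : ∀ e ∈ E, ∀ s : Fin e.numVars → Term S X,
    d (e.lhs.subst s) (e.rhs.subst s) ≤ (e.ε : ℝ≥0∞)
  var : ∀ x y : X, d (.var x) (.var y) ≤ edist x y

/-- The largest admissible pseudometric. -/
noncomputable def freeDist (X : Met.{u}) (t t' : Term S X) : ℝ≥0∞ :=
  ⨆ d : {d // IsAdmissible E X d}, d.1 t t'

variable {E} {X : Met.{u}}

theorem IsAdmissible.le_freeDist {d : Term S X → Term S X → ℝ≥0∞} (h : IsAdmissible E X d)
    (t t' : Term S X) : d t t' ≤ freeDist E X t t' :=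
  le_iSup (fun d : {d // IsAdmissible E X d} => d.1 t t') ⟨d, h⟩

-- Each clause bounds `d` from above by a quantity that is constant or monotone in `d`, so suprema
-- preserve it.
variable (E X) in
theorem isAdmissible_freeDist : IsAdmissible E X (freeDist E X) where
  toIsPseudoDist := isPseudoDist_iSup (d := fun d : {d // IsAdmissible E X d} => d.1)
    fun d => d.2.toIsPseudoDist
  op σ a b := iSup_le fun d => (d.2.op σ a b).trans
    (iSup_mono fun i => d.2.le_freeDist (a i) (b i))
  eqn e he s := iSup_le fun d => d.2.eqn e he s
  var x y := iSup_le fun d => d.2.var x y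

/-- Together with maximality of `freeDist`, this makes evaluation in `A` nonexpanding on terms. -/
theorem isAdmissible_eval {A : Alg S} (hA : ∀ e ∈ E, A.Satisfies e) {g : X → A.space}
    (hg : ∀ x y, edist (g x) (g y) ≤ edist x y) :
    IsAdmissible E X fun t t' => edist (A.eval g t) (A.eval g t') where
  toIsPseudoDist := isPseudoDist_edist _
  op σ a b := A.nonexpanding σ _ _
  eqn e he s := by
    simp only [Term.eval_subst]
    exact hA e he _
  var := hg

/-- The maximum metric on arguments keeps the bound `r` unchanged under every operation. This is
what makes the free-algebra functor enriched. -/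
theorem freeDist_map_map_le {W : Type*} {f g : W → X} {r : ℝ≥0∞}
    (h : ∀ x, edist (f x) (g x) ≤ r) (t : Term S W) : freeDist E X (t.map f) (t.map g) ≤ r := by
  induction t with
  | var x => exact ((isAdmissible_freeDist E X).var _ _).trans (h x)
  | app σ t ih => exact ((isAdmissible_freeDist E X).op σ _ _).trans (iSup_le ih)

/-- For a unary signature, the free distance of terms over `X` is determined by the distances of
the variables and by the free distance of terms over finite discrete spaces. -/
theorem le_freeDist_of_unary (hS : ∀ n : ℕ, 1 < n → IsEmpty (S n))
    {d : Term S X → Term S X → ℝ≥0∞} (hd : IsPseudoDist d)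
    (hvar : ∀ (u : Term S Unit) (x y : X), d (u.map fun _ => x) (u.map fun _ => y) ≤ edist x y)
    (hdisc : ∀ (K : Met.{u}), K.IsFinDiscrete → ∀ (k : K → X) (t t' : Term S K),
      d (t.map k) (t'.map k) ≤ freeDist E K t t')
    (t t' : Term S X) : d t t' ≤ freeDist E X t t' := by
  -- The given `d` need not make the operations nonexpanding. The largest `D` with the same three
  -- properties does, and it dominates `d`.
  let Good (d : Term S X → Term S X → ℝ≥0∞) : Prop := IsPseudoDist d ∧
    (∀ (u : Term S Unit) (x y : X), d (u.map fun _ => x) (u.map fun _ => y) ≤ edist x y) ∧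
    ∀ (K : Met.{u}), K.IsFinDiscrete → ∀ (k : K → X) (t t' : Term S K),
      d (t.map k) (t'.map k) ≤ freeDist E K t t'
  let D (t t' : Term S X) : ℝ≥0∞ := ⨆ d : {d // Good d}, d.1 t t'
  have le_D {d} (hd : Good d) (t t') : d t t' ≤ D t t' :=
    le_iSup (fun d : {d // Good d} => d.1 t t') ⟨d, hd⟩
  have hD : IsPseudoDist D := isPseudoDist_iSup (d := fun d : {d // Good d} => d.1) fun d => d.2.1
  have hDdisc (K : Met.{u}) (hK : K.IsFinDiscrete) (k : K → X) (t t' : Term S K) :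
      D (t.map k) (t'.map k) ≤ freeDist E K t t' := iSup_le fun d => d.2.2.2 K hK k t t'
  have hDvar (u : Term S Unit) (x y : X) :
      D (u.map fun _ => x) (u.map fun _ => y) ≤ edist x y := iSup_le fun d => d.2.2.1 u x y
  -- The pullback of `D` along `σ` is again good, hence at most `D`, which says that `σ` is
  -- nonexpanding. The condition ranges over all `u` so that `u` can be replaced by `σ u` here.
  have hunary (σ : S 1) : Good fun t t' => D (.app σ fun _ => t) (.app σ fun _ => t') := by
    refine ⟨⟨fun _ => hD.self _, fun _ _ => hD.comm _ _, fun _ _ _ => hD.triangle _ _ _⟩,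
      fun u x y => hDvar (.app σ fun _ => u) x y, fun K hK k t t' =>
        (hDdisc K hK k (.app σ fun _ => t) (.app σ fun _ => t')).trans
          (((isAdmissible_freeDist E K).op σ _ _).trans (iSup_le fun _ => le_rfl))⟩
  have hadm : IsAdmissible E X D :=
    { toIsPseudoDist := hD
      op := by
        intro n σ a b
        match n, σ, a, b with
        | 0, σ, a, b => rw [Subsingleton.elim a b, hD.self]; exact zero_le
        | 1, σ, a, b =>
          have ha : a = fun _ => a 0 := funext fun i => congrArg a (Subsingleton.elim i 0)
          have hb : b = fun _ => b 0 := funext fun i => congrArg b (Subsingleton.elim i 0)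
          refine le_trans ?_ (le_iSup (fun i => D (a i) (b i)) 0)
          rw [ha, hb]
          exact le_D (hunary σ) (a 0) (b 0)
        | n + 2, σ, a, b => exact ((hS (n + 2) (by omega)).false σ).elim
      eqn := by
        intro e he s
        obtain ⟨K, hK, k, s', hs'⟩ := exists_discrete_factor s
        obtain rfl : (fun i => (s' i).map k) = s := funext hs'
        rw [← Term.subst_map, ← Term.subst_map]
        exact (hDdisc K hK k _ _).trans ((isAdmissible_freeDist E K).eqn e he s')
      var := fun x y => hDvar (.var ()) x y }
  exact (le_D ⟨hd, hvar, hdisc⟩ t t').trans (hadm.le_freeDist t t')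

end FreeDist

/-! ## Free algebras -/

section Free

variable {S : Signature.{u}} {E : Set (Equation S)} {c : Prop}

theorem Alg.eval_edist_le (A : Alg S) {m : ℕ} (t : Term S (Fin m)) (f g : Fin m → A.space) :
    edist (A.eval f t) (A.eval g t) ≤ edist f g := by
  induction t with
  | var x => exact edist_le_pi_edist f g x
  | app σ t ih => exact (A.nonexpanding σ _ _).trans (iSup_le ih)

theorem Alg.op_edist_le (A : Alg S) {n : ℕ} (σ : S n) (a b : Fin n → A.space) :
    edist (A.op σ a) (A.op σ b) ≤ edist a b :=
  (A.nonexpanding σ a b).trans (iSup_le fun i => edist_le_pi_edist a b i)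

variable (E c) in
/-- The algebra `A` is generated by the image of `X`, and the distances of the values of terms
are the free ones. -/
structure IsFreeOn (X : Met.{u}) (A : Alg S) (η : X → A.space) : Prop where
  generating : IsGenerating c (A.eval η)
  edist_eval : ∀ t t', edist (A.eval η t) (A.eval η t') = freeDist E X t t'

-- The operations extend from tuples of terms, which are dense or exhaust all tuples. The equations
-- hold there and persist in the limit because evaluation of a term is continuous in the
-- interpretation.
variable (c E) in
theorem exists_isFreeOn (X : Met.{u}) :
    ∃ (A : Alg S) (η : X → A.space), (∀ e ∈ E, A.Satisfies e) ∧ (c → CompleteSpace A.space) ∧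
      (∀ x y, edist (η x) (η y) ≤ edist x y) ∧ IsFreeOn E c X A η := by
  have hD := isAdmissible_freeDist E X
  let _ : PseudoEMetricSpace (Term S X) :=
    { edist := freeDist E X
      edist_self := hD.self
      edist_comm := hD.comm
      edist_triangle := hD.triangle }
  obtain ⟨Z, e, hZ, he, hed⟩ := exists_isGenerating c (Term S X)
  have hop {n : ℕ} (σ : S n) := (he.pi n).exists_extension hZ (fun a => e (.app σ a)) fun a b => by
    rw [hed]
    refine (hD.op σ a b).trans (iSup_le fun i => ?_)
    exact (hed (a i) (b i)).symm.le.trans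
      (edist_le_pi_edist (fun i => e (a i)) (fun i => e (b i)) i)
  let op {n : ℕ} (σ : S n) : (Fin n → Z) → Z := (hop σ).choose
  have op_e {n : ℕ} (σ : S n) (a : Fin n → Term S X) : op σ (fun i => e (a i)) = e (.app σ a) :=
    (hop σ).choose_spec.2 a
  let A : Alg S :=
    { space := Z
      op := op
      nonexpanding := fun σ a b => ((hop σ).choose_spec.1 a b).trans
        (edist_pi_le_iff.2 fun i => le_iSup (fun i => edist (a i) (b i)) i) }
  have hsub {V : Type} (s : V → Term S X) (t : Term S V) :
      A.eval (fun x => e (s x)) t = e (t.subst s) := by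
    induction t with
    | var x => rfl
    | app σ t ih =>
      simp only [Alg.eval, ih]
      exact op_e σ _
  have heval : A.eval (fun x => e (.var x)) = e := by
    funext t
    induction t with
    | var x => rfl
    | app σ t ih =>
      simp only [Alg.eval, ih]
      exact op_e σ _
  refine ⟨A, fun x => e (.var x), fun q hq f => ?_, hZ, fun x y => ?_, ?_, ?_⟩
  · refine (he.pi q.numVars).1.edist_le_of_forall
      (continuous_of_edist_le (A.eval_edist_le q.lhs))
      (continuous_of_edist_le (A.eval_edist_le q.rhs)) (fun s => ?_) f
    rw [hsub, hsub, hed]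
    exact hD.eqn q hq s
  · rw [hed]
    exact hD.var x y
  · rw [heval]
    exact he
  · rw [heval]
    exact hed

variable {X : Met.{u}} {A B : Alg S} {η : X → A.space}

theorem Alg.Hom.map_eval {V : Type*} (h : A ⟶ B) (g : V → A.space) (t : Term S V) :
    h.map.toFun (A.eval g t) = B.eval (fun x => h.map.toFun (g x)) t := by
  induction t with
  | var x => rfl
  | app σ t ih =>
    simp only [Alg.eval, ← ih]
    exact h.map_op σ _

/-- The universal property of the free algebra. -/
theorem IsFreeOn.existsUnique_hom (h : IsFreeOn E c X A η) (hB : ∀ e ∈ E, B.Satisfies e)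
    (hBc : c → CompleteSpace B.space) {g : X → B.space}
    (hg : ∀ x y, edist (g x) (g y) ≤ edist x y) :
    ∃! f : A ⟶ B, ∀ x, f.map.toFun (η x) = g x := by
  obtain ⟨f, hf, hfe⟩ := h.generating.exists_extension hBc (B.eval g) fun t t' =>
    ((isAdmissible_eval hB hg).le_freeDist t t').trans (h.edist_eval t t').ge
  have hfc : Continuous f := continuous_of_edist_le hf
  refine ⟨⟨⟨f, hf⟩, fun {n} σ a => ?_⟩, fun x => hfe (.var x), fun f' hf' => ?_⟩
  · refine congrFun ((h.generating.pi n).1.equalizer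
      (hfc.comp (continuous_of_edist_le (A.op_edist_le σ)))
      ((continuous_of_edist_le (B.op_edist_le σ)).comp
        (continuous_pi fun i => hfc.comp (continuous_apply i))) (funext fun t => ?_)) a
    simp only [Function.comp_apply, hfe]
    exact hfe (.app σ t)
  · refine Alg.Hom.ext (Met.Hom.ext ?_)
    refine h.generating.1.equalizer (continuous_of_edist_le f'.map.nonexpanding) hfc
      (funext fun t => ?_)
    simp only [Function.comp_apply, hfe]
    rw [f'.map_eval]
    exact congrArg (fun g => B.eval g t) (funext hf')

end Free

/-! ## A criterion for strong finitarity -/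

section Criterion

variable {C : Type w} [Category.{v} C] {U : C ⥤ Met.{u}}

theorem toFun_map_comp {X Y Z : C} (f : X ⟶ Y) (g : Y ⟶ Z) (x : U.obj X) :
    (U.map (f ≫ g)).toFun x = (U.map g).toFun ((U.map f).toFun x) := by
  rw [U.map_comp]
  rfl

theorem toFun_map_id (X : C) : (U.map (𝟙 X)).toFun = fun x => x := by
  rw [U.map_id]
  rfl

theorem Met.Hom.continuous {X Y : Met.{u}} (f : X ⟶ Y) : Continuous f.toFun :=
  continuous_of_edist_le f.nonexpanding

theorem edist_le_homDist {X Y : C} (f g : X ⟶ Y) (x : U.obj X) :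
    edist ((U.map f).toFun x) ((U.map g).toFun x) ≤ homDist U f g :=
  le_iSup (fun x => edist ((U.map f).toFun x) ((U.map g).toFun x)) x

theorem hom_ext_toFun [U.Faithful] {X Y : C} {f g : X ⟶ Y}
    (h : (U.map f).toFun = (U.map g).toFun) : f = g :=
  U.map_injective (Met.Hom.ext h)

theorem eq_of_natDist_eq_zero [U.Faithful] {A : Type*} [Category A] {F G : A ⥤ C} {α β : F ⟶ G}
    (h : natDist U α β = 0) : α = β := by
  ext X
  refine hom_ext_toFun (U := U) (funext fun x => edist_le_zero.1 ?_)
  rw [← h]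
  exact (edist_le_homDist _ _ x).trans (le_iSup (fun X => homDist U (α.app X) (β.app X)) X)

theorem exists_map_toFun_eq [U.Full] {K X : C} (hK : (U.obj K).IsFinDiscrete)
    (k : U.obj K → U.obj X) : ∃ f : K ⟶ X, (U.map f).toFun = k := by
  have hk : ∀ x y, edist (k x) (k y) ≤ edist x y := fun x y => by
    by_cases h : x = y
    · simp [h]
    · rw [hK.2 x y h]
      exact le_top
  obtain ⟨f, hf⟩ := U.map_surjective (⟨k, hk⟩ : U.obj K ⟶ U.obj X)
  exact ⟨f, by rw [hf]⟩

variable {S : Signature.{u}} {E : Set (Equation S)} {c : Prop} {T : C ⥤ C}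

variable (U E c T) in
/-- The objects `T.obj X` are generated by terms over `X` with the free distance. -/
structure IsFreeFunctor (e : ∀ X : C, Term S (U.obj X) → U.obj (T.obj X)) : Prop where
  generating : ∀ X, IsGenerating c (e X)
  edist_eq : ∀ X t t', edist (e X t) (e X t') = freeDist E (U.obj X) t t'
  map_eq : ∀ {X Y : C} (f : X ⟶ Y) t,
    (U.map (T.map f)).toFun (e X t) = e Y (t.map (U.map f).toFun)

namespace IsFreeFunctor

variable {e : ∀ X : C, Term S (U.obj X) → U.obj (T.obj X)}

theorem homDist_le (he : IsFreeFunctor U E c T e) {X Y : C} {f g : T.obj X ⟶ Y} {r : ℝ≥0∞}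
    (h : ∀ t, edist ((U.map f).toFun (e X t)) ((U.map g).toFun (e X t)) ≤ r) :
    homDist U f g ≤ r :=
  iSup_le ((he.generating X).1.edist_le_of_forall (Met.Hom.continuous _)
    (Met.Hom.continuous _) h)

theorem isEnriched (he : IsFreeFunctor U E c T e) : IsEnriched U T := by
  intro X Y f g
  refine he.homDist_le fun t => ?_
  rw [he.map_eq, he.map_eq, he.edist_eq]
  exact freeDist_map_map_le (edist_le_homDist f g) t

theorem hom_ext [U.Faithful] (he : IsFreeFunctor U E c T e) {X Y : C} {f g : T.obj X ⟶ Y}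
    (h : ∀ t, (U.map f).toFun (e X t) = (U.map g).toFun (e X t)) : f = g :=
  hom_ext_toFun ((he.generating X).1.equalizer (Met.Hom.continuous _) (Met.Hom.continuous _)
    (funext h))

theorem exists_factor (hfin : ∀ K : Met.{u}, K.IsFinDiscrete → ∃ X : C, U.obj X = K) [U.Full]
    {X : C} (t : Term S (U.obj X)) :
    ∃ (K : (finDiscrete U).FullSubcategory) (k : K.obj ⟶ X) (t' : Term S (U.obj K.obj)),
      t'.map (U.map k).toFun = t := by
  obtain ⟨K, hK, k, t', ht'⟩ := exists_discrete_factor (fun _ : Fin 1 => t)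
  obtain ⟨K, rfl⟩ := hfin K hK
  obtain ⟨k, rfl⟩ := exists_map_toFun_eq hK k
  exact ⟨⟨K, hK⟩, k, t' 0, ht' 0⟩

/-- Naturality along `k : K ⟶ X` carries a bound at `K` to every term over `X` coming from `K`.
Besides isometry this yields uniqueness of extensions, as the case of distance zero. -/
theorem natDist_eq (he : IsFreeFunctor U E c T e) [U.Full]
    (hfin : ∀ K : Met.{u}, K.IsFinDiscrete → ∃ X : C, U.obj X = K) {G : C ⥤ C} (β β' : T ⟶ G) :
    natDist U (Functor.whiskerLeft (finDiscrete U).ι β)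
      (Functor.whiskerLeft (finDiscrete U).ι β') = natDist U β β' := by
  refine le_antisymm (iSup_le fun K => ?_) (iSup_le fun X => he.homDist_le fun t => ?_)
  · exact le_iSup (fun X => homDist U (β.app X) (β'.app X)) K.obj
  · obtain ⟨K, k, t, rfl⟩ := exists_factor hfin t
    rw [← he.map_eq, ← toFun_map_comp, ← toFun_map_comp, β.naturality, β'.naturality,
      toFun_map_comp, toFun_map_comp]
    refine ((U.map (G.map k)).nonexpanding _ _).trans ((edist_le_homDist _ _ _).trans ?_)
    exact le_iSup (fun K : (finDiscrete U).FullSubcategory =>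
      homDist U ((Functor.whiskerLeft (finDiscrete U).ι β).app K)
        ((Functor.whiskerLeft (finDiscrete U).ι β').app K)) K

section Extension

variable {G : C ⥤ C} (α : (finDiscrete U).ι ⋙ T ⟶ (finDiscrete U).ι ⋙ G)

variable (e) in
/-- The value of the extension of `α` at a term over `X` coming from a finite discrete space. -/
def extValue {X : C} (K : (finDiscrete U).FullSubcategory) (k : K.obj ⟶ X)
    (t : Term S (U.obj K.obj)) : U.obj (G.obj X) :=
  (U.map (G.map k)).toFun ((U.map (α.app K)).toFun (e K.obj t))

theorem extValue_comp (he : IsFreeFunctor U E c T e) {X : C}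
    {K L : (finDiscrete U).FullSubcategory} (p : K ⟶ L) (k : L.obj ⟶ X)
    (t : Term S (U.obj K.obj)) :
    extValue e α K (p.hom ≫ k) t = extValue e α L k (t.map (U.map p.hom).toFun) := by
  rw [extValue, extValue, ← he.map_eq, G.map_comp, toFun_map_comp]
  congr 1
  have := α.naturality p
  simp only [Functor.comp_map, ObjectProperty.ι_map] at this
  rw [← toFun_map_comp, ← this, ← toFun_map_comp]

theorem extValue_congr (he : IsFreeFunctor U E c T e) [U.Full] [U.Faithful]
    (hfin : ∀ K : Met.{u}, K.IsFinDiscrete → ∃ X : C, U.obj X = K) {X : C}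
    {K L : (finDiscrete U).FullSubcategory} {k : K.obj ⟶ X} {l : L.obj ⟶ X}
    {t : Term S (U.obj K.obj)} {s : Term S (U.obj L.obj)}
    (h : t.map (U.map k).toFun = s.map (U.map l).toFun) :
    extValue e α K k t = extValue e α L l s := by
  let R : Set (U.obj X) := Set.range (U.map k).toFun ∪ Set.range (U.map l).toFun
  have := K.property.1
  have := L.property.1
  have hR : Finite R := (Set.finite_range _).union (Set.finite_range _)
  -- The discrete space on the union of the two images. A bijection `i` replaces the equality of
  -- spaces from `hfin`, which avoids casts.
  obtain ⟨M, hM⟩ : ∃ M : C, ∃ i : R → U.obj M, Function.Bijective i ∧ (U.obj M).IsFinDiscrete := by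
    obtain ⟨M, hM⟩ := hfin (Met.discrete R) (Met.isFinDiscrete_discrete R)
    rw [← show (Met.discrete R : Type u) = R from rfl, ← hM]
    exact ⟨M, id, Function.bijective_id, hM ▸ Met.isFinDiscrete_discrete R⟩
  obtain ⟨i, hi, hMd⟩ := hM
  let j := Equiv.ofBijective i hi
  obtain ⟨m, hm⟩ := exists_map_toFun_eq hMd fun x => ((j.symm x : R) : U.obj X)
  obtain ⟨p, hp⟩ := exists_map_toFun_eq K.property
    fun x => i ⟨(U.map k).toFun x, Or.inl ⟨x, rfl⟩⟩
  obtain ⟨q, hq⟩ := exists_map_toFun_eq L.property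
    fun x => i ⟨(U.map l).toFun x, Or.inr ⟨x, rfl⟩⟩
  have hpk : p ≫ m = k := hom_ext_toFun (funext fun x => by
    rw [toFun_map_comp, hp, hm]
    exact congrArg Subtype.val (j.symm_apply_apply _))
  have hql : q ≫ m = l := hom_ext_toFun (funext fun x => by
    rw [toFun_map_comp, hq, hm]
    exact congrArg Subtype.val (j.symm_apply_apply _))
  let M' : (finDiscrete U).FullSubcategory := ⟨M, hMd⟩
  have hm_inj : Function.Injective (U.map m).toFun := by
    rw [hm]
    exact Subtype.val_injective.comp j.symm.injective
  -- Renaming along the injection `m` is injective, so the two terms already agree over `M`.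
  have hst : t.map (U.map p).toFun = s.map (U.map q).toFun := by
    apply Term.map_injective hm_inj
    simp only [Term.map_map, ← toFun_map_comp, hpk, hql]
    exact h
  subst hpk hql
  have h₁ := extValue_comp α he (L := M') (ObjectProperty.homMk p) m t
  have h₂ := extValue_comp α he (L := M') (ObjectProperty.homMk q) m s
  exact h₁.trans ((congrArg (extValue e α M' m) hst).trans h₂.symm)

/-- The forced values on terms form a map that is nonexpanding for `freeDist`, so it extends along
the generating map `e X`. -/
theorem exists_extension (he : IsFreeFunctor U E c T e) [U.Full] [U.Faithful]
    (hfin : ∀ K : Met.{u}, K.IsFinDiscrete → ∃ X : C, U.obj X = K)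
    (hcompl : ∀ X : C, c → CompleteSpace (U.obj X))
    (hS : ∀ n : ℕ, 1 < n → IsEmpty (S n)) (hG : IsEnriched U G) (X : C) :
    ∃ f : T.obj X ⟶ G.obj X, ∀ (K : (finDiscrete U).FullSubcategory) (k : K.obj ⟶ X)
      (t : Term S (U.obj K.obj)),
      (U.map f).toFun (e X (t.map (U.map k).toFun)) = extValue e α K k t := by
  choose K k s hs using fun t : Term S (U.obj X) => exists_factor hfin t
  let b (t : Term S (U.obj X)) : U.obj (G.obj X) := extValue e α (K t) (k t) (s t)
  have hb (L : (finDiscrete U).FullSubcategory) (l : L.obj ⟶ X) (t : Term S (U.obj L.obj)) :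
      b (t.map (U.map l).toFun) = extValue e α L l t :=
    extValue_congr α he hfin (hs _)
  obtain ⟨g, hg, hgb⟩ := (he.generating X).exists_extension (hcompl (G.obj X)) b fun t t' => by
    rw [he.edist_eq]
    refine le_freeDist_of_unary hS (isPseudoDist_edist b) (fun u x y => ?_)
      (fun L hL l t t' => ?_) t t'
    -- Points `x`, `y` are morphisms from the one-point space, at distance `edist x y`. Enrichment
    -- of `G` bounds the distance of their images under `G`.
    · have hP := Met.isFinDiscrete_discrete PUnit.{u + 1}
      obtain ⟨p⟩ : Nonempty (Met.discrete PUnit.{u + 1}) := ⟨PUnit.unit⟩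
      generalize Met.discrete PUnit.{u + 1} = P at hP p
      obtain ⟨P, rfl⟩ := hfin P hP
      obtain ⟨x', hx⟩ := exists_map_toFun_eq hP fun _ => x
      obtain ⟨y', hy⟩ := exists_map_toFun_eq hP fun _ => y
      have hbx := hb ⟨P, hP⟩ x' (u.map fun _ => p)
      have hby := hb ⟨P, hP⟩ y' (u.map fun _ => p)
      rw [Term.map_map, hx] at hbx
      rw [Term.map_map, hy] at hby
      rw [hbx, hby]
      refine (edist_le_homDist _ _ _).trans ((hG x' y').trans (iSup_le fun _ => ?_))
      rw [hx, hy]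
    -- On terms from `L` the map is `α` at `L` followed by `G.map l`, both nonexpanding.
    · obtain ⟨L, rfl⟩ := hfin L hL
      obtain ⟨l, rfl⟩ := exists_map_toFun_eq hL l
      change edist (b _) (b _) ≤ _
      rw [hb ⟨L, hL⟩, hb ⟨L, hL⟩, ← he.edist_eq]
      exact ((U.map (G.map l)).nonexpanding _ _).trans
        ((U.map (α.app ⟨L, hL⟩)).nonexpanding _ _)
  obtain ⟨f, hf⟩ := U.map_surjective (⟨g, hg⟩ : U.obj (T.obj X) ⟶ U.obj (G.obj X))
  refine ⟨f, fun L l t => ?_⟩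
  rw [hf]
  exact (hgb _).trans (hb L l t)

end Extension

theorem isStronglyFinitary (he : IsFreeFunctor U E c T e) [U.Full] [U.Faithful]
    (hfin : ∀ K : Met.{u}, K.IsFinDiscrete → ∃ X : C, U.obj X = K)
    (hcompl : ∀ X : C, c → CompleteSpace (U.obj X))
    (hS : ∀ n : ℕ, 1 < n → IsEmpty (S n)) : IsStronglyFinitary U T where
  enriched := he.isEnriched
  existsUnique G hG α := by
    choose b hb using he.exists_extension α hfin hcompl hS hG
    let β : T ⟶ G :=
      { app := b
        naturality := fun X Y f => he.hom_ext fun t => by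
          obtain ⟨K, k, t, rfl⟩ := exists_factor hfin t
          rw [toFun_map_comp, toFun_map_comp, he.map_eq, hb X K k t, Term.map_map]
          simp only [← toFun_map_comp]
          rw [hb Y K (k ≫ f) t, extValue, extValue, G.map_comp, toFun_map_comp] }
    have hβ : Functor.whiskerLeft (finDiscrete U).ι β = α := by
      ext K
      refine he.hom_ext fun t => ?_
      -- A term over a finite discrete space represents itself through the identity.
      have := hb K.obj K (𝟙 _) t
      simp only [toFun_map_id, Term.map_id, extValue, G.map_id] at this
      exact this
    refine ⟨β, ?_, fun β' hβ' => ?_⟩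
    · exact (Category.id_comp _).trans hβ
    · refine eq_of_natDist_eq_zero (U := U) ?_
      rw [← he.natDist_eq hfin, ((Category.id_comp _).symm.trans hβ').trans hβ.symm]
      exact le_antisymm (iSup_le fun X => iSup_le fun x => (edist_self _).le) zero_le
  isometric G _ β β' := by
    rw [← he.natDist_eq hfin β β']
    exact congrArg₂ (natDist U) (Category.id_comp _) (Category.id_comp _)

end IsFreeFunctor

end Criterion

/-! ## Free-algebra monads -/

section Monad

theorem isRightAdjoint_of_forall_exists {C : Type*} [Category C] {D : Type*} [Category D]
    {G : D ⥤ C} (h : ∀ X : C, ∃ (A : D) (η : X ⟶ G.obj A), ∀ (B : D) (g : X ⟶ G.obj B),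
      ∃! f : A ⟶ B, η ≫ G.map f = g) : G.IsRightAdjoint := by
  have (X : C) : Limits.HasInitial (StructuredArrow X G) := by
    obtain ⟨A, η, hA⟩ := h X
    choose f hf huniq using fun B : StructuredArrow X G => hA B.right B.hom
    exact (Limits.IsInitial.ofUniqueHom (X := StructuredArrow.mk η)
      (fun B => StructuredArrow.homMk (f B) (hf B))
      fun B m => StructuredArrow.ext _ _ (huniq B m.right (StructuredArrow.w m))).hasInitial
  exact isRightAdjointOfStructuredArrowInitials G

variable {S : Signature.{u}} {E : Set (Equation S)} {c : Prop}

/-- Every algebra with the universal property of the free algebra is generated by terms with the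
free distance. -/
theorem isFreeOn_of_universal {X : Met.{u}} {B : Alg S} {ζ : X → B.space}
    (hB : ∀ e ∈ E, B.Satisfies e) (hBc : c → CompleteSpace B.space)
    (hζ : ∀ x y, edist (ζ x) (ζ y) ≤ edist x y)
    (hex : ∀ A : Alg S, (∀ e ∈ E, A.Satisfies e) → (c → CompleteSpace A.space) →
      ∀ g : X ⟶ A.space, ∃ f : B ⟶ A, ∀ x, f.map.toFun (ζ x) = g.toFun x)
    (huniq : ∀ f : B ⟶ B, (∀ x, f.map.toFun (ζ x) = ζ x) → f = 𝟙 B) :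
    IsFreeOn E c X B ζ := by
  obtain ⟨A, η, hA, hAc, hη, hfree⟩ := exists_isFreeOn E c X
  obtain ⟨φ, hφ, -⟩ := hfree.existsUnique_hom hB hBc hζ
  obtain ⟨ψ, hψ⟩ := hex A hA hAc ⟨η, hη⟩
  -- This one composite suffices: it makes `φ` surjective, which transports generation from `A` to
  -- `B`; the lower bound on distances comes from `ψ` being nonexpanding.
  have hid : ψ ≫ φ = 𝟙 B := huniq _ fun x =>
    (congrArg φ.map.toFun (hψ x)).trans (hφ x)
  have hφe : φ.map.toFun ∘ A.eval η = B.eval ζ := funext fun t =>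
    (φ.map_eval η t).trans (congrArg (fun g => B.eval g t) (funext hφ))
  have hψe (t) : ψ.map.toFun (B.eval ζ t) = A.eval η t :=
    (ψ.map_eval ζ t).trans (congrArg (fun g => A.eval g t) (funext hψ))
  have hsurj : Function.Surjective φ.map.toFun := fun b =>
    ⟨ψ.map.toFun b, congrArg (fun f : B ⟶ B => f.map.toFun b) hid⟩
  refine ⟨hφe ▸ hfree.generating.comp φ.map.continuous hsurj, fun t t' => le_antisymm ?_ ?_⟩
  · exact (isAdmissible_eval hB hζ).le_freeDist t t'
  · rw [← hfree.edist_eval, ← hψe, ← hψe]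
    exact ψ.map.nonexpanding _ _

variable (E) in
theorem Variety.isRightAdjoint_forget : (Variety.forget E).IsRightAdjoint := by
  refine isRightAdjoint_of_forall_exists fun X => ?_
  obtain ⟨A, η, hA, -, hη, hfree⟩ := exists_isFreeOn E False X
  refine ⟨⟨A, hA⟩, ⟨η, hη⟩, fun B g => ?_⟩
  obtain ⟨f, hf, huniq⟩ := hfree.existsUnique_hom B.property (fun h => h.elim) g.nonexpanding
  exact ⟨ObjectProperty.homMk f, Met.Hom.ext (funext hf), fun f' hf' =>
    ObjectProperty.hom_ext _ (huniq f'.hom fun x => congrArg (fun g => Met.Hom.toFun g x) hf')⟩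

variable (E) in
theorem CVariety.isRightAdjoint_forget : (CVariety.forget E).IsRightAdjoint := by
  refine isRightAdjoint_of_forall_exists fun X => ?_
  obtain ⟨A, η, hA, hAc, hη, hfree⟩ := exists_isFreeOn E True X.obj
  refine ⟨⟨A, hA, hAc trivial⟩, ObjectProperty.homMk ⟨η, hη⟩, fun B g => ?_⟩
  obtain ⟨f, hf, huniq⟩ := hfree.existsUnique_hom B.property.1 (fun _ => B.property.2)
    g.hom.nonexpanding
  exact ⟨ObjectProperty.homMk f, ObjectProperty.hom_ext _ (Met.Hom.ext (funext hf)),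
    fun f' hf' => ObjectProperty.hom_ext _
      (huniq f'.hom fun x => congrArg (fun g => Met.Hom.toFun (InducedCategory.Hom.hom g) x) hf')⟩

theorem Variety.isFreeFunctor {F : Met.{u} ⥤ Variety E} (adj : F ⊣ Variety.forget E) :
    IsFreeFunctor (𝟭 Met.{u}) E False adj.toMonad.toFunctor
      (fun X => (F.obj X).obj.eval (adj.unit.app X).toFun) := by
  have hfree (X : Met.{u}) : IsFreeOn E False X (F.obj X).obj (adj.unit.app X).toFun := by
    refine isFreeOn_of_universal (F.obj X).property (fun h => h.elim)
      (adj.unit.app X).nonexpanding (fun A hA _ g => ?_) fun f hf => ?_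
    · refine ⟨((adj.homEquiv X ⟨A, hA⟩).symm g).hom, fun x => ?_⟩
      have := (adj.homEquiv X ⟨A, hA⟩).apply_symm_apply g
      rw [adj.homEquiv_unit] at this
      exact congrArg (fun g => Met.Hom.toFun g x) this
    · have h : ObjectProperty.homMk f = 𝟙 (F.obj X) := (adj.homEquiv _ _).injective (by
        rw [adj.homEquiv_unit, adj.homEquiv_unit]
        exact Met.Hom.ext (funext hf))
      exact congrArg InducedCategory.Hom.hom h
  refine ⟨fun X => (hfree X).generating, fun X => (hfree X).edist_eval, fun {X Y} f t => ?_⟩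
  refine ((F.map f).hom.map_eval _ t).trans ?_
  refine Eq.trans ?_ (Term.eval_map _ _ _ t).symm
  refine congrArg (fun g => (F.obj Y).obj.eval g t) (funext fun x => ?_)
  exact (congrArg (fun g => Met.Hom.toFun g x) (adj.unit.naturality f)).symm

theorem CVariety.isFreeFunctor {F : CMet.{u} ⥤ CVariety E} (adj : F ⊣ CVariety.forget E) :
    IsFreeFunctor CMet.incl.{u} E True adj.toMonad.toFunctor
      (fun X => (F.obj X).obj.eval (adj.unit.app X).hom.toFun) := by
  have hfree (X : CMet.{u}) :
      IsFreeOn E True X.obj (F.obj X).obj (adj.unit.app X).hom.toFun := by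
    refine isFreeOn_of_universal (F.obj X).property.1 (fun _ => (F.obj X).property.2)
      (adj.unit.app X).hom.nonexpanding (fun A hA hAc g => ?_) fun f hf => ?_
    · let A' : CVariety E := ⟨A, hA, hAc trivial⟩
      let g' : X ⟶ (CVariety.forget E).obj A' := ObjectProperty.homMk g
      refine ⟨((adj.homEquiv X A').symm g').hom, fun x => ?_⟩
      have := (adj.homEquiv X A').apply_symm_apply g'
      rw [adj.homEquiv_unit] at this
      exact congrArg (fun g => Met.Hom.toFun (InducedCategory.Hom.hom g) x) this
    · have h : ObjectProperty.homMk f = 𝟙 (F.obj X) := (adj.homEquiv _ _).injective (by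
        rw [adj.homEquiv_unit, adj.homEquiv_unit]
        exact ObjectProperty.hom_ext _ (Met.Hom.ext (funext hf)))
      exact congrArg InducedCategory.Hom.hom h
  refine ⟨fun X => (hfree X).generating, fun X => (hfree X).edist_eval, fun {X Y} f t => ?_⟩
  refine ((F.map f).hom.map_eval _ t).trans ?_
  refine Eq.trans ?_ (Term.eval_map _ _ _ t).symm
  refine congrArg (fun g => (F.obj Y).obj.eval g t) (funext fun x => ?_)
  exact (congrArg (fun g => Met.Hom.toFun (InducedCategory.Hom.hom g) x)
    (adj.unit.naturality f)).symm

theorem Met.IsFinDiscrete.completeSpace {K : Met.{u}} (hK : K.IsFinDiscrete) :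
    CompleteSpace K := by
  have : Finite K := hK.1
  infer_instance

end Monad

end QuantAlg

/-- Unary varieties: every space generates a free algebra, and the free-algebra monad (the monad
of any adjunction with the forgetful functor as right adjoint) is strongly finitary; for
algebras on metric spaces and for algebras on complete metric spaces. -/
theorem theorem6p10 (S : QuantAlg.Signature.{u}) (hS : ∀ n : ℕ, 1 < n → IsEmpty (S n))
    (E : Set (QuantAlg.Equation S)) :
    ((QuantAlg.Variety.forget E).IsRightAdjoint ∧
      ∀ (F : QuantAlg.Met.{u} ⥤ QuantAlg.Variety E) (adj : F ⊣ QuantAlg.Variety.forget E),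
        QuantAlg.IsStronglyFinitary (𝟭 QuantAlg.Met.{u}) adj.toMonad.toFunctor) ∧
    ((QuantAlg.CVariety.forget E).IsRightAdjoint ∧
      ∀ (F : QuantAlg.CMet.{u} ⥤ QuantAlg.CVariety E) (adj : F ⊣ QuantAlg.CVariety.forget E),
        QuantAlg.IsStronglyFinitary QuantAlg.CMet.incl.{u} adj.toMonad.toFunctor) :=
  ⟨⟨QuantAlg.Variety.isRightAdjoint_forget E, fun _ adj =>
      (QuantAlg.Variety.isFreeFunctor adj).isStronglyFinitary (fun K _ => ⟨K, rfl⟩)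
        (fun _ h => h.elim) hS⟩,
    ⟨QuantAlg.CVariety.isRightAdjoint_forget E, fun _ adj =>
      (QuantAlg.CVariety.isFreeFunctor adj).isStronglyFinitary
        (fun K hK => ⟨⟨K, hK.completeSpace⟩, rfl⟩) (fun X _ => X.property) hS⟩⟩
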